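/- Let $\nu>0$, $d\ge 1$, $j\in\{1,\dots,d\}$. For a positive definite $d\times d$ matrix $\Sigma$ and $\mu\in\mathbb{R}^d$, let $\mathrm{St}_\nu^d(\mu,\Sigma)$ be the distribution on $\mathbb{R}^d$ with density \[ f(y)=C_\nu^d(\Sigma)\,\bigl[1+(y-\mu)^\top\Sigma^{-1}(y-\mu)/\nu\bigr]^{-(\nu+d)/2},\qquad C_\nu^d(\Sigma)=\frac{\Gamma((\nu+d)/2)}{\Gamma(\nu/2)\,|\Sigma|^{1/2}(\nu\pi)^{d/2}}, \] and let $F_\nu^d(\cdot\,;\mu,\Sigma)$ be its cumulative distribution function. Let $Y=(Y_1,\dots,Y_d)\sim \mathrm{St}_\nu^d(0,\Sigma)$, where $\Sigma=(\rho_{k,l})$ is a positive definite correlation matrix. Write $Y_{-j}$ for $Y$ without its $j$th component, $\rho_j=(\rho_{k,j})_{k\ne j}$ and $\Sigma_{-j|j}=(\rho_{k,l}-\rho_{j,k}\rho_{j,l})_{k,l\ne j}$. (i) The standardised vector \[ \frac{Y_{-j}-\rho_jY_j}{(\nu+Y_j^2)^{1/2}}\,(\nu+1)^{1/2} \] has the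 distribution $\mathrm{St}_{\nu+1}^{d-1}(0,\Sigma_{-j|j})$, and this is also its conditional distribution given $Y_j=y$, for almost every $y$. (ii) Let $T:\mathbb{R}\to\mathbb{R}$ be nondecreasing with $\mathrm{P}(T(Y_j)>x)\sim e^{-x}$ as $x\to\infty$, and let $X=(T(Y_1),\dots,T(Y_d))$. Then every function $T^{-1}$ with $T(T^{-1}(x))=x$ for all large $x$ satisfies $T^{-1}(x)\sim K^{1/\nu}e^{x/\nu}$ as $x\to\infty$, where $K=C_\nu^1(1)\,\nu^{(\nu-1)/2}$. Moreover $\mathrm{P}(X_j>t)>0$ for all $t$ and, with the normalisations $a(x)=x$ and $b(x)=1$, \[ \bigl(X-X_j,\;X_j-t\bigr)\,\big|\,X_j>t\;\overset{d}{\longrightarrow}\;(Z^j,E),\qquad t\to\infty, \] where the convergence is in $[-\infty,\infty]^d\times\mathbb{R}$, $E\sim\mathrm{Exp}(1)$ is independent of $Z^j$, $Z^j_j=0$ almost surely, and for all $z\in\mathbb{R}^{d-1}$ \[ \mathrm{P}(Z^j_{-j}\le z)=F_{\nu+1}^{d-1}\bigl(e^{z/\nu};\,\rho_j,\,\Sigma_{-j|j}/(\nu+1)\bigr),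 \] with $e^{z/\nu}$ taken componentwise. The limit $Z^j$ has no mass at $+\infty$ in any component, and $0<\mathrm{P}(Z^j_k=-\infty)<1$ for every $k\neq j$. -/

import Mathlib

open MeasureTheory ProbabilityTheory Filter Asymptotics
open scoped Matrix

noncomputable section

/-- The normalization constant
`Γ((ν + d)/2) / (Γ(ν/2) |Σ|^{1/2} (νπ)^{d/2})`, `d` being the number of indices. -/
def studentTConst {ι : Type*} [Fintype ι] [DecidableEq ι] (ν : ℝ) (S : Matrix ι ι ℝ) : ℝ :=
  Real.Gamma ((ν + Fintype.card ι) / 2) /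
    (Real.Gamma (ν / 2) * Real.sqrt S.det * (ν * Real.pi) ^ ((Fintype.card ι : ℝ) / 2))

/-- The density of the multivariate Student `t` distribution with `ν` degrees of freedom,
location `m` and dispersion matrix `S`. -/
def studentTPDF {ι : Type*} [Fintype ι] [DecidableEq ι] (ν : ℝ) (m : ι → ℝ) (S : Matrix ι ι ℝ)
    (y : ι → ℝ) : ℝ :=
  studentTConst ν S *
    (1 + ((y - m) ⬝ᵥ (S⁻¹ *ᵥ (y - m))) / ν) ^ (-(ν + Fintype.card ι) / 2)

/-- The multivariate Student `t` distribution `St_ν^d(m, S)`. -/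
def studentT {ι : Type*} [Fintype ι] [DecidableEq ι] (ν : ℝ) (m : ι → ℝ) (S : Matrix ι ι ℝ) :
    Measure (ι → ℝ) :=
  volume.withDensity (fun y => ENNReal.ofReal (studentTPDF ν m S y))

/-- The cumulative distribution function of `St_ν^d(m, S)`
(`Set.Iic y` is the orthant of all points that are `≤ y` in every coordinate). -/
def studentTCDF {ι : Type*} [Fintype ι] [DecidableEq ι] (ν : ℝ) (m : ι → ℝ) (S : Matrix ι ι ℝ)
    (y : ι → ℝ) : ℝ :=
  (studentT ν m S).real (Set.Iic y)

/-- A (nondegenerate) correlation matrix. -/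
def IsCorrelationMatrix {ι : Type*} [Fintype ι] (S : Matrix ι ι ℝ) : Prop :=
  S.PosDef ∧ ∀ k, S k k = 1

/-- The `j`-th column of `S` without its `j`-th entry. -/
def columnWithout {d : ℕ} (S : Matrix (Fin d) (Fin d) ℝ) (j : Fin d) : {k : Fin d // k ≠ j} → ℝ :=
  fun k => S k j

/-- The matrix `(ρ_{k,l} - ρ_{j,k} ρ_{j,l})_{k,l ≠ j}`. -/
def partialMatrix {d : ℕ} (S : Matrix (Fin d) (Fin d) ℝ) (j : Fin d) :
    Matrix {k : Fin d // k ≠ j} {k : Fin d // k ≠ j} ℝ :=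
  Matrix.of fun k l => S k l - S j k * S j l

/-- `(y_{-j} - ρ_j y_j) (ν + 1)^{1/2} / (ν + y_j²)^{1/2}`. -/
def standardizedResidual {d : ℕ} (ν : ℝ) (S : Matrix (Fin d) (Fin d) ℝ) (j : Fin d)
    (y : Fin d → ℝ) : {k : Fin d // k ≠ j} → ℝ :=
  fun k => (y k - columnWithout S j k * y j) / Real.sqrt (ν + y j ^ 2) * Real.sqrt (ν + 1)

end

/-! Completing the square in the quadratic form of `S⁻¹` isolates `y j` and leaves the form of the
Schur complement `partialMatrix S j` in y_{-j} - ρ_j y_j. Writing that difference as √((ν + y_j²)/(ν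
+ 1)) r turns 1 + (quadratic form)/ν into (1 + y_j²/ν)(1 + q(r)/(ν + 1)). Jacobian and constants
match, so the Student density factorizes: Y_j and the standardized residual R are independent with
explicit laws (`studentT_eq_map_ofResidual`). Part (i) can be read off.

For part (ii), beyond a high threshold u the univariate law is asymptotically K u^{-ν} times the
Pareto law of index ν on (u, ∞). Hence, given Y_j > u, the pair (Y_j/u, R) tends to (s, R) with s
standard Pareto and independent of R (`tendsto_rpow_mul_integral_Ioi`). Comparing tails gives T(u) =
ν log u - log K + o(1) (`tendsto_quantile_transform`), which determines the right inverses. As Y_j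
grows with R fixed, Y_k/Y_j tends to ρ_{k,j} + R_k/√(ν + 1), so T(Y_k) - T(Y_j) tends to ν times its
logarithm, or to -∞ if it is not positive, while T(Y_j) - t tends to ν log s, an exponential
variable. This convergence holds pointwise in (s, R) (`tendsto_marginIncrements_ofResidual`), and
dominated convergence transfers it to bounded continuous test functions. -/

/-! ### Schur complement of a correlation matrix -/

section Matrices

variable {d : ℕ} {S : Matrix (Fin d) (Fin d) ℝ} {j : Fin d}

lemma sum_eq_add_sum_ne (j : Fin d) (f : Fin d → ℝ) :
    ∑ k, f k = f j + ∑ k : {k : Fin d // k ≠ j}, f k := by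
  rw [← Finset.add_sum_erase _ _ (Finset.mem_univ j)]
  congr 1
  exact (Finset.sum_subtype _ (by simp) f)

lemma IsCorrelationMatrix.symm_apply (hS : IsCorrelationMatrix S) (k l : Fin d) :
    S k l = S l k := by
  simpa using hS.1.isHermitian.apply l k

/-- A vector x is extended by the `j`-th entry that makes the `j`-th entry of `S *ᵥ v` vanish; the
form of `S` at v is then the form of the Schur complement at x. -/
lemma IsCorrelationMatrix.partialMatrix_posDef (hS : IsCorrelationMatrix S) (j : Fin d) :
    (partialMatrix S j).PosDef := by
  refine Matrix.PosDef.of_dotProduct_mulVec_pos ?_ fun x hx => ?_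
  · ext k l
    simp [partialMatrix, hS.symm_apply k l, mul_comm]
  · set c : ℝ := ∑ l : {k : Fin d // k ≠ j}, S j l * x l with hc
    set v : Fin d → ℝ := fun k => if h : k ≠ j then x ⟨k, h⟩ else -c with hv
    have hvj : v j = -c := by simp [hv]
    have hvk (k : {k : Fin d // k ≠ j}) : v k = x k := by simp [hv, k.2]
    have hv0 : v ≠ 0 := by
      intro h
      apply hx
      ext k
      rw [← hvk k, h]
      rfl
    have key := hS.1.dotProduct_mulVec_pos hv0
    have hrow (k : {k : Fin d // k ≠ j}) :
        (S *ᵥ v) k = (partialMatrix S j *ᵥ x) k := by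
      simp only [Matrix.mulVec, dotProduct]
      rw [sum_eq_add_sum_ne j]
      simp only [hvj, hvk, partialMatrix, Matrix.of_apply, sub_mul, Finset.sum_sub_distrib]
      simp only [mul_assoc, ← Finset.mul_sum, ← hc]
      rw [hS.symm_apply k j]; ring
    have hrowj : (S *ᵥ v) j = 0 := by
      simp only [Matrix.mulVec, dotProduct]
      rw [sum_eq_add_sum_ne j]
      simp only [hvj, hvk, ← hc, hS.2 j]
      ring
    have : star v ⬝ᵥ (S *ᵥ v) = star x ⬝ᵥ (partialMatrix S j *ᵥ x) := by
      simp only [dotProduct]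
      rw [sum_eq_add_sum_ne j, hrowj]
      simp [hrow, hvk]
    rwa [this] at key

lemma IsCorrelationMatrix.det_partialMatrix (hS : IsCorrelationMatrix S) (j : Fin d) :
    (partialMatrix S j).det = S.det := by
  rw [Matrix.det_toBlock S (fun k => k ≠ j)]
  have : Unique {k : Fin d // ¬ k ≠ j} :=
    ⟨⟨⟨j, by simp⟩⟩, fun a => Subtype.ext (by simpa using a.2)⟩
  have h1 : S.toBlock (fun k => ¬ k ≠ j) (fun k => ¬ k ≠ j) = 1 := by
    ext a b
    rw [Subsingleton.elim a default, Subsingleton.elim b default]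
    simp [Matrix.toBlock, hS.2]
  rw [h1, Matrix.det_fromBlocks_one₂₂]
  congr 1
  ext k l
  simp only [partialMatrix, Matrix.of_apply, Matrix.sub_apply, Matrix.mul_apply,
    Fintype.sum_unique, Matrix.toBlock_apply]
  have : ((default : {k : Fin d // ¬ k ≠ j}) : Fin d) = j := by
    simpa using (default : {k : Fin d // ¬ k ≠ j}).2
  rw [this, hS.symm_apply k j]

/-- Completing the square: the quadratic form of `S⁻¹` splits off the `j`-th coordinate. -/
lemma IsCorrelationMatrix.dotProduct_inv_mulVec (hS : IsCorrelationMatrix S) (j : Fin d)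
    (y : Fin d → ℝ) (x : {k : Fin d // k ≠ j} → ℝ)
    (hx : ∀ k : {k : Fin d // k ≠ j}, y k = columnWithout S j k * y j + x k) :
    y ⬝ᵥ (S⁻¹ *ᵥ y) = y j ^ 2 + x ⬝ᵥ ((partialMatrix S j)⁻¹ *ᵥ x) := by
  set q := (partialMatrix S j)⁻¹ *ᵥ x with hq
  have hPq : partialMatrix S j *ᵥ q = x := by
    rw [hq, Matrix.mulVec_mulVec, Matrix.mul_nonsing_inv, Matrix.one_mulVec]
    exact (hS.partialMatrix_posDef j).det_pos.ne'.isUnit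
  -- The vector v below is the solution of `S *ᵥ v = y`, guessed from block elimination; verifying
  -- it avoids a block formula for `S⁻¹`.
  set c : ℝ := ∑ l : {k : Fin d // k ≠ j}, S j l * q l with hc
  set v : Fin d → ℝ := fun k => if h : k ≠ j then q ⟨k, h⟩ else y j - c with hv
  have hvj : v j = y j - c := by simp [hv]
  have hvk (k : {k : Fin d // k ≠ j}) : v k = q k := by simp [hv, k.2]
  have hSv : S *ᵥ v = y := by
    ext k
    simp only [Matrix.mulVec, dotProduct]
    rw [sum_eq_add_sum_ne j]
    simp only [hvj, hvk]
    by_cases hk : k = j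
    · subst hk
      rw [hS.2, ← hc]; ring
    · have h1 := congrFun hPq ⟨k, hk⟩
      simp only [Matrix.mulVec, dotProduct, partialMatrix, Matrix.of_apply, sub_mul,
        Finset.sum_sub_distrib, mul_assoc, ← Finset.mul_sum, ← hc] at h1
      have h2 := hx ⟨k, hk⟩
      simp only [columnWithout] at h2
      rw [h2, ← h1, hS.symm_apply j k]
      ring
  have hinv : S⁻¹ *ᵥ y = v := by
    rw [← hSv, Matrix.mulVec_mulVec, Matrix.nonsing_inv_mul, Matrix.one_mulVec]
    exact hS.1.det_pos.ne'.isUnit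
  rw [hinv]
  simp only [dotProduct]
  rw [sum_eq_add_sum_ne j, hvj]
  simp only [hvk, hx, columnWithout, add_mul, Finset.sum_add_distrib]
  have : ∑ k : {k : Fin d // k ≠ j}, S k j * y j * q k = y j * c := by
    rw [hc, Finset.mul_sum]
    refine Finset.sum_congr rfl fun k _ => ?_
    rw [hS.symm_apply k j]; ring
  rw [this]; ring

end Matrices

/-! ### The univariate Student distribution and its total mass -/

noncomputable section

/-- The density of the standard univariate Student `t` distribution. -/
def univStudentTPDF (ν y : ℝ) : ℝ :=
  studentTConst ν (1 : Matrix (Fin 1) (Fin 1) ℝ) * (1 + y ^ 2 / ν) ^ (-(ν + 1) / 2)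

/-- The standard univariate Student `t` distribution. -/
def univStudentT (ν : ℝ) : Measure ℝ :=
  volume.withDensity fun y => ENNReal.ofReal (univStudentTPDF ν y)

end

lemma studentTConst_pos {ι : Type*} [Fintype ι] [DecidableEq ι] {ν : ℝ} (hν : 0 < ν)
    {S : Matrix ι ι ℝ} (hS : 0 < S.det) : 0 < studentTConst ν S := by
  unfold studentTConst
  have h1 : 0 < Real.Gamma ((ν + Fintype.card ι) / 2) := Real.Gamma_pos_of_pos (by positivity)
  have h2 : 0 < Real.Gamma (ν / 2) := Real.Gamma_pos_of_pos (by positivity)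
  have h3 := Real.sqrt_pos.2 hS
  have h4 := Real.pi_pos
  positivity

lemma studentTConst_one_pos {ν : ℝ} (hν : 0 < ν) :
    0 < studentTConst ν (1 : Matrix (Fin 1) (Fin 1) ℝ) :=
  studentTConst_pos hν (by simp)

@[fun_prop]
lemma measurable_univStudentTPDF (ν : ℝ) : Measurable (univStudentTPDF ν) := by
  unfold univStudentTPDF
  fun_prop

lemma univStudentTPDF_pos {ν : ℝ} (hν : 0 < ν) (y : ℝ) : 0 < univStudentTPDF ν y := by
  have := studentTConst_one_pos hν
  unfold univStudentTPDF
  positivity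

lemma lintegral_gaussian {b : ℝ} (hb : 0 < b) :
    ∫⁻ y : ℝ, ENNReal.ofReal (Real.exp (-b * y ^ 2)) = ENNReal.ofReal (√(Real.pi / b)) := by
  rw [← integral_gaussian b, ofReal_integral_eq_lintegral_ofReal (integrable_exp_neg_mul_sq hb)]
  exact ae_of_all _ fun y => (Real.exp_pos _).le

lemma lintegral_rpow_mul_exp_neg_mul_Ioi {a r : ℝ} (ha : 0 < a) (hr : 0 < r) :
    ∫⁻ t : ℝ in Set.Ioi 0, ENNReal.ofReal (t ^ (a - 1) * Real.exp (-(r * t)))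
      = ENNReal.ofReal ((1 / r) ^ a * Real.Gamma a) := by
  have key := Real.integral_rpow_mul_exp_neg_mul_Ioi ha hr
  have hG := Real.Gamma_pos_of_pos ha
  rw [← key, ofReal_integral_eq_lintegral_ofReal]
  · exact .of_integral_ne_zero (by rw [key]; positivity)
  · filter_upwards [ae_restrict_mem measurableSet_Ioi] with t ht
    have : (0 : ℝ) < t := ht
    positivity

/-- The integral `∫ (1 + y² / ν) ^ (-s) dy`, computed by mixing Gaussians. -/
lemma lintegral_one_add_sq_div_rpow_neg {ν s : ℝ} (hν : 0 < ν) (hs : 1 / 2 < s) :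
    ∫⁻ y : ℝ, ENNReal.ofReal ((1 + y ^ 2 / ν) ^ (-s))
      = ENNReal.ofReal (√(Real.pi * ν) * Real.Gamma (s - 1 / 2) / Real.Gamma s) := by
  have hs0 : 0 < s := by linarith
  have hG := Real.Gamma_pos_of_pos hs0
  -- The Gamma integral represents r^{-s}. After Tonelli, the Gaussian integral in y contributes
  -- t^{-1/2}, leaving a Gamma integral of parameter s - 1/2.
  have h1 (y : ℝ) : ENNReal.ofReal ((1 + y ^ 2 / ν) ^ (-s)) = ENNReal.ofReal (Real.Gamma s)⁻¹ *
      ∫⁻ t : ℝ in Set.Ioi 0, ENNReal.ofReal (t ^ (s - 1) * Real.exp (-((1 + y ^ 2 / ν) * t))) := by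
    have hr : 0 < 1 + y ^ 2 / ν := by positivity
    rw [lintegral_rpow_mul_exp_neg_mul_Ioi hs0 hr, ← ENNReal.ofReal_mul (by positivity)]
    congr 1
    rw [one_div, Real.inv_rpow hr.le, Real.rpow_neg hr.le]
    field_simp
  have h2 {t : ℝ} (ht : t ∈ Set.Ioi (0 : ℝ)) :
      ∫⁻ y : ℝ, ENNReal.ofReal (t ^ (s - 1) * Real.exp (-((1 + y ^ 2 / ν) * t)))
        = ENNReal.ofReal (√(Real.pi * ν)) *
          ENNReal.ofReal (t ^ ((s - 1 / 2) - 1) * Real.exp (-(1 * t))) := by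
    have ht : 0 < t := ht
    have hb : 0 < t / ν := by positivity
    calc _ = ∫⁻ y : ℝ, ENNReal.ofReal (t ^ (s - 1) * Real.exp (-t)) *
            ENNReal.ofReal (Real.exp (-(t / ν) * y ^ 2)) := by
          refine lintegral_congr fun y => ?_
          rw [← ENNReal.ofReal_mul (by positivity), mul_assoc, ← Real.exp_add]
          congr 3
          field_simp
          ring
      _ = _ := by
          rw [lintegral_const_mul _ (by fun_prop), lintegral_gaussian hb,
            ← ENNReal.ofReal_mul (by positivity), ← ENNReal.ofReal_mul (by positivity)]
          congr 1
          have : s - 1 / 2 - 1 = (s - 1) - 1 / 2 := by ring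
          rw [this, Real.rpow_sub ht (s - 1) (1 / 2), ← Real.sqrt_eq_rpow, div_div_eq_mul_div,
            Real.sqrt_div (by positivity), one_mul]
          ring
  simp_rw [h1]
  rw [lintegral_const_mul' _ _ ENNReal.ofReal_ne_top, lintegral_lintegral_swap,
    setLIntegral_congr_fun measurableSet_Ioi fun t ht => h2 ht,
    lintegral_const_mul' _ _ ENNReal.ofReal_ne_top,
    lintegral_rpow_mul_exp_neg_mul_Ioi (by linarith) one_pos,
    ← ENNReal.ofReal_mul (by positivity), ← ENNReal.ofReal_mul (by positivity)]
  · congr 1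
    simp
    field_simp
  · refine Measurable.aemeasurable ?_
    unfold Function.uncurry
    fun_prop

lemma isProbabilityMeasure_univStudentT {ν : ℝ} (hν : 0 < ν) :
    IsProbabilityMeasure (univStudentT ν) where
  measure_univ := by
    have hC := studentTConst_one_pos hν
    rw [univStudentT, withDensity_apply _ .univ, Measure.restrict_univ]
    simp_rw [univStudentTPDF, ENNReal.ofReal_mul hC.le]
    have : -(ν + 1) / 2 = -((ν + 1) / 2) := by ring
    rw [lintegral_const_mul' _ _ ENNReal.ofReal_ne_top, this,
      lintegral_one_add_sq_div_rpow_neg hν (by linarith), ← ENNReal.ofReal_mul hC.le,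
      ENNReal.ofReal_eq_one, studentTConst]
    have h1 : 0 < Real.Gamma ((ν + 1) / 2) := Real.Gamma_pos_of_pos (by positivity)
    have h2 : 0 < Real.Gamma (ν / 2) := Real.Gamma_pos_of_pos (by positivity)
    have h3 : (ν + 1) / 2 - 1 / 2 = ν / 2 := by ring
    have h4 : 0 < Real.pi * ν := by positivity
    have h5 := Real.sqrt_pos.2 h4
    simp only [h3, Fintype.card_fin, Nat.cast_one, Matrix.det_one, Real.sqrt_one, mul_one,
      ← Real.sqrt_eq_rpow, mul_comm ν]
    field_simp

/-! ### Factorization into one coordinate and the standardized residual -/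

noncomputable section

/-- The vector with `j`-th coordinate `p.1` and remaining coordinates `p.2`. -/
def insertCoord {d : ℕ} (j : Fin d) (p : ℝ × ({k : Fin d // k ≠ j} → ℝ)) : Fin d → ℝ :=
  fun k => if h : k ≠ j then p.2 ⟨k, h⟩ else p.1

/-- The vector with `j`-th coordinate `p.1` and standardized residual `p.2`. -/
def ofResidual {d : ℕ} (ν : ℝ) (S : Matrix (Fin d) (Fin d) ℝ) (j : Fin d)
    (p : ℝ × ({k : Fin d // k ≠ j} → ℝ)) : Fin d → ℝ :=
  insertCoord j (p.1, p.1 • columnWithout S j + (√(ν + p.1 ^ 2) / √(ν + 1)) • p.2)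

end

section Factorization

variable {d : ℕ} {S : Matrix (Fin d) (Fin d) ℝ} {j : Fin d} {ν : ℝ}

@[simp]
lemma insertCoord_self (p : ℝ × ({k : Fin d // k ≠ j} → ℝ)) : insertCoord j p j = p.1 := by
  simp [insertCoord]

@[simp]
lemma insertCoord_coe (p : ℝ × ({k : Fin d // k ≠ j} → ℝ)) (k : {k : Fin d // k ≠ j}) :
    insertCoord j p k = p.2 k := by
  simp [insertCoord, k.2]

@[simp]
lemma ofResidual_self (p : ℝ × ({k : Fin d // k ≠ j} → ℝ)) : ofResidual ν S j p j = p.1 := by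
  simp [ofResidual]

lemma ofResidual_coe (p : ℝ × ({k : Fin d // k ≠ j} → ℝ)) (k : {k : Fin d // k ≠ j}) :
    ofResidual ν S j p k = columnWithout S j k * p.1 + √(ν + p.1 ^ 2) / √(ν + 1) * p.2 k := by
  simp [ofResidual, mul_comm]

@[fun_prop]
lemma measurable_insertCoord : Measurable (insertCoord j) := by
  refine measurable_pi_lambda _ fun k => ?_
  by_cases h : k = j
  · subst h
    simpa using measurable_fst
  · simp only [insertCoord, ne_eq, h, not_false_eq_true, dite_true]
    fun_prop

@[fun_prop]
lemma measurable_ofResidual : Measurable (ofResidual ν S j) := by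
  unfold ofResidual
  fun_prop

@[fun_prop]
lemma measurable_standardizedResidual : Measurable (standardizedResidual ν S j) := by
  unfold standardizedResidual
  fun_prop

lemma standardizedResidual_ofResidual (hν : 0 < ν) (p : ℝ × ({k : Fin d // k ≠ j} → ℝ)) :
    standardizedResidual ν S j (ofResidual ν S j p) = p.2 := by
  ext k
  have h1 : 0 < √(ν + p.1 ^ 2) := Real.sqrt_pos.2 (by positivity)
  have h2 : 0 < √(ν + 1) := Real.sqrt_pos.2 (by positivity)
  simp only [standardizedResidual, ofResidual_self, ofResidual_coe]
  field_simp
  ring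

lemma measurePreserving_insertCoord (j : Fin d) :
    MeasurePreserving (insertCoord j)
      ((volume : Measure ℝ).prod (volume : Measure ({k : Fin d // k ≠ j} → ℝ))) volume := by
  have : Unique {k : Fin d // ¬ k ≠ j} :=
    ⟨⟨⟨j, by simp⟩⟩, fun a => Subtype.ext (by simpa using a.2)⟩
  have h1 : MeasurePreserving _ (Measure.prod volume volume) volume :=
    (volume_preserving_piEquivPiSubtypeProd (fun _ : Fin d => ℝ) (fun k => k ≠ j)).symm
  have h2 : MeasurePreserving (MeasurableEquiv.funUnique {k : Fin d // ¬ k ≠ j} ℝ).symm volume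
      (@volume _ (@MeasureSpace.pi _ (Subtype.fintype _) _ _)) := by
    convert (volume_preserving_funUnique {k : Fin d // ¬ k ≠ j} ℝ).symm
  have h3 := (MeasurePreserving.id
    (volume : Measure ({k : Fin d // k ≠ j} → ℝ))).prod h2
  have h4 := h1.comp (h3.comp (Measure.measurePreserving_swap
    (μ := (volume : Measure ℝ)) (ν := (volume : Measure ({k : Fin d // k ≠ j} → ℝ)))))
  exact h4

lemma lintegral_eq_lintegral_add_smul {ι : Type*} [Fintype ι] {a : ℝ} (ha : 0 < a) (c : ι → ℝ)
    {g : (ι → ℝ) → ENNReal} (hg : Measurable g) :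
    ∫⁻ x, g x = ENNReal.ofReal (a ^ Fintype.card ι) * ∫⁻ x, g (c + a • x) := by
  rw [← lintegral_add_left_eq_self g c,
    ← lintegral_map (f := fun x => g (c + x)) (by fun_prop) (measurable_const_smul a),
    Measure.map_addHaar_smul _ ha.ne', lintegral_smul_measure, smul_eq_mul, ← mul_assoc,
    ← ENNReal.ofReal_mul (by positivity), Module.finrank_fintype_fun_eq_card,
    abs_of_pos (by positivity), mul_inv_cancel₀ (by positivity), ENNReal.ofReal_one, one_mul]

@[fun_prop]
lemma measurable_studentTPDF {ι : Type*} [Fintype ι] [DecidableEq ι] (ν : ℝ) (m : ι → ℝ)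
    (S : Matrix ι ι ℝ) : Measurable (studentTPDF ν m S) := by
  unfold studentTPDF
  simp only [dotProduct, Matrix.mulVec]
  fun_prop

lemma quadForm_inv_nonneg {ι : Type*} [Fintype ι] [DecidableEq ι] {S : Matrix ι ι ℝ}
    (hS : S.PosDef) (x : ι → ℝ) : 0 ≤ x ⬝ᵥ (S⁻¹ *ᵥ x) := by
  simpa using hS.inv.posSemidef.dotProduct_mulVec_nonneg x

lemma studentTPDF_pos {ι : Type*} [Fintype ι] [DecidableEq ι] {S : Matrix ι ι ℝ} {ν : ℝ}
    (hν : 0 < ν) (hS : S.PosDef) (m y : ι → ℝ) : 0 < studentTPDF ν m S y := by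
  have := quadForm_inv_nonneg hS (y - m)
  have := studentTConst_pos hν hS.det_pos
  unfold studentTPDF
  positivity

lemma cast_eq_card_ne_add_one (j : Fin d) :
    (d : ℝ) = Fintype.card {k : Fin d // k ≠ j} + 1 := by
  have := Fintype.card_subtype_compl (fun k : Fin d => k = j)
  have hd : 0 < d := j.pos
  simp only [Fintype.card_subtype_eq, Fintype.card_fin] at this
  have h2 : Fintype.card {k : Fin d // k ≠ j} = d - 1 := this
  rw [h2]
  push_cast [hd]
  simp

/-- The power of ν/(ν + 1) is the part of the Jacobian that does not depend on y. The factors Γ((ν +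
1)/2) cancel, and the determinants agree by `det_partialMatrix`. -/
lemma studentTConst_mul_rpow (hν : 0 < ν) (hS : IsCorrelationMatrix S) (j : Fin d) :
    studentTConst ν S * (ν / (ν + 1)) ^ ((Fintype.card {k : Fin d // k ≠ j} : ℝ) / 2)
      = studentTConst ν (1 : Matrix (Fin 1) (Fin 1) ℝ)
        * studentTConst (ν + 1) (partialMatrix S j) := by
  have hc := cast_eq_card_ne_add_one j
  have h0 : 0 < Real.sqrt S.det := Real.sqrt_pos.2 hS.1.det_pos
  have h1 : 0 < Real.Gamma ((ν + 1) / 2) := Real.Gamma_pos_of_pos (by positivity)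
  have h2 : 0 < Real.Gamma (ν / 2) := Real.Gamma_pos_of_pos (by positivity)
  have hpi := Real.pi_pos
  simp only [studentTConst, hS.det_partialMatrix, Fintype.card_fin, Nat.cast_one,
    Matrix.det_one, Real.sqrt_one, mul_one, hc]
  set n : ℝ := (Fintype.card {k : Fin d // k ≠ j} : ℝ)
  have h3 : (ν + (n + 1)) / 2 = (ν + 1 + n) / 2 := by ring
  have h4 : (n + 1) / 2 = n / 2 + 1 / 2 := by ring
  rw [h3, h4, Real.rpow_add (by positivity), Real.div_rpow hν.le (by positivity),
    Real.mul_rpow hν.le hpi.le (z := n / 2), Real.mul_rpow (by positivity) hpi.le (z := n / 2)]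
  have h5 : 0 < ν ^ (n / 2) := by positivity
  have h6 : 0 < (ν + 1) ^ (n / 2) := by positivity
  have h7 : 0 < Real.pi ^ (n / 2) := by positivity
  have h8 : 0 < (ν * Real.pi) ^ ((1 : ℝ) / 2) := by positivity
  field_simp

/-- The leading factor is the Jacobian of r ↦ y_{-j} at fixed y. Its y-dependent part raises the
exponent of 1 + y²/ν from -(ν + d)/2 to -(ν + 1)/2. -/
lemma studentTPDF_ofResidual (hν : 0 < ν) (hS : IsCorrelationMatrix S) (y : ℝ)
    (r : {k : Fin d // k ≠ j} → ℝ) :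
    (√(ν + y ^ 2) / √(ν + 1)) ^ Fintype.card {k : Fin d // k ≠ j}
        * studentTPDF ν 0 S (ofResidual ν S j (y, r))
      = univStudentTPDF ν y * studentTPDF (ν + 1) 0 (partialMatrix S j) r := by
  have hc := cast_eq_card_ne_add_one j
  have hconst := studentTConst_mul_rpow hν hS j
  have hquad := hS.dotProduct_inv_mulVec j (ofResidual ν S j (y, r))
    ((√(ν + y ^ 2) / √(ν + 1)) • r) (fun k => by simp [ofResidual_coe])
  have hq0 := quadForm_inv_nonneg (hS.partialMatrix_posDef j) r
  simp only [studentTPDF, univStudentTPDF, sub_zero, Fintype.card_fin, hc, hquad, ofResidual_self,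
    Matrix.mulVec_smul, dotProduct_smul, smul_dotProduct, smul_eq_mul]
  set q := r ⬝ᵥ ((partialMatrix S j)⁻¹ *ᵥ r)
  rw [← Real.sqrt_div (by positivity), ← mul_assoc (√_), Real.mul_self_sqrt (by positivity)]
  set n := Fintype.card {k : Fin d // k ≠ j}
  have hA : 0 < 1 + y ^ 2 / ν := by positivity
  have hB : 0 < 1 + q / (ν + 1) := by positivity
  have e1 : 1 + (y ^ 2 + (ν + y ^ 2) / (ν + 1) * q) / ν = (1 + y ^ 2 / ν) * (1 + q / (ν + 1)) := by
    field_simp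
    ring
  have e2 : √((ν + y ^ 2) / (ν + 1)) ^ n
      = (1 + y ^ 2 / ν) ^ ((n : ℝ) / 2) * (ν / (ν + 1)) ^ ((n : ℝ) / 2) := by
    rw [← Real.mul_rpow hA.le (by positivity), Real.sqrt_eq_rpow,
      ← Real.rpow_mul_natCast (by positivity)]
    congr 1
    · field_simp
    · ring
  have e3 : -(ν + 1) / 2 = n / 2 + -(ν + (n + 1)) / 2 := by ring
  have e4 : -(ν + 1 + (n : ℝ)) / 2 = -(ν + (n + 1)) / 2 := by ring
  rw [e1, e2, e3, e4, Real.rpow_add hA, Real.mul_rpow hA.le hB.le]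
  linear_combination (1 + y ^ 2 / ν) ^ ((n : ℝ) / 2) *
    ((1 + y ^ 2 / ν) ^ (-(ν + (n + 1)) / 2) * (1 + q / (ν + 1)) ^ (-(ν + (n + 1)) / 2)) * hconst

/-- The `j`-th coordinate and the standardized residual of a Student vector are independent. -/
lemma studentT_eq_map_ofResidual (hν : 0 < ν) (hS : IsCorrelationMatrix S) (j : Fin d) :
    studentT ν 0 S
      = ((univStudentT ν).prod (studentT (ν + 1) 0 (partialMatrix S j))).map (ofResidual ν S j) := by
  refine Measure.ext_of_lintegral _ fun g hg => ?_
  rw [lintegral_map hg (by fun_prop), univStudentT, studentT, studentT,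
    prod_withDensity (by fun_prop) (by fun_prop),
    lintegral_withDensity_eq_lintegral_mul _ (by fun_prop) hg,
    lintegral_withDensity_eq_lintegral_mul _ (by fun_prop) (by fun_prop),
    ← (measurePreserving_insertCoord j).lintegral_comp (by fun_prop),
    lintegral_prod _ (by fun_prop), lintegral_prod _ (by fun_prop)]
  refine lintegral_congr fun y => ?_
  have ha : 0 < √(ν + y ^ 2) / √(ν + 1) :=
    div_pos (Real.sqrt_pos.2 (by positivity)) (Real.sqrt_pos.2 (by positivity))
  rw [lintegral_eq_lintegral_add_smul ha (y • columnWithout S j) (by fun_prop),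
    ← lintegral_const_mul' _ _ ENNReal.ofReal_ne_top]
  refine lintegral_congr fun r => ?_
  have := studentTPDF_ofResidual (j := j) hν hS y r
  simp only [Pi.mul_apply]
  rw [← ENNReal.ofReal_mul (univStudentTPDF_pos hν y).le, ← this, ← mul_assoc,
    ← ENNReal.ofReal_mul (by positivity)]
  rfl

/-- Total masses multiply in the factorization, so no multivariate normalization integral is needed.
-/
lemma isProbabilityMeasure_studentT_partialMatrix (hν : 0 < ν) (hS : IsCorrelationMatrix S)
    [IsProbabilityMeasure (studentT ν 0 S)] (j : Fin d) :
    IsProbabilityMeasure (studentT (ν + 1) 0 (partialMatrix S j)) where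
  measure_univ := by
    have := isProbabilityMeasure_univStudentT hν
    have : SFinite (studentT (ν + 1) 0 (partialMatrix S j)) := by
      unfold studentT
      infer_instance
    have h := measure_univ (μ := studentT ν 0 S)
    rwa [studentT_eq_map_ofResidual hν hS j, Measure.map_apply (by fun_prop) .univ,
      Set.preimage_univ, ← Set.univ_prod_univ, Measure.prod_prod, measure_univ, one_mul] at h

end Factorization

/-! ### Affine images and positivity of Student laws -/

lemma studentTPDF_add_smul {ι : Type*} [Fintype ι] [DecidableEq ι] {S : Matrix ι ι ℝ} {ν a : ℝ}
    (ha : 0 < a) (hS : S.PosDef) (m r : ι → ℝ) :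
    a ^ Fintype.card ι * studentTPDF ν m ((a ^ 2) • S) (m + a • r) = studentTPDF ν 0 S r := by
  have hdet : ((a ^ 2) • S).det = (a ^ Fintype.card ι) ^ 2 * S.det := by
    rw [Matrix.det_smul]; ring
  have h0 := Real.sqrt_pos.2 hS.det_pos
  have hinv : ((a ^ 2) • S)⁻¹ = (a ^ 2)⁻¹ • S⁻¹ := by
    have := invertibleOfNonzero (pow_pos ha 2).ne'
    rw [Matrix.inv_smul _ _ hS.det_pos.ne'.isUnit, invOf_eq_inv]
  have hquad : (m + a • r - m) ⬝ᵥ (((a ^ 2) • S)⁻¹ *ᵥ (m + a • r - m)) = r ⬝ᵥ (S⁻¹ *ᵥ r) := by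
    simp only [add_sub_cancel_left, hinv, Matrix.mulVec_smul, Matrix.smul_mulVec, dotProduct_smul,
      smul_dotProduct, smul_eq_mul]
    field_simp
  simp only [studentTPDF, hquad, sub_zero, studentTConst, hdet]
  rw [Real.sqrt_mul (by positivity), Real.sqrt_sq (by positivity)]
  have : 0 < a ^ Fintype.card ι := by positivity
  field_simp

/-- Student distributions form a location-scale family. -/
lemma map_studentT_add_smul {ι : Type*} [Fintype ι] [DecidableEq ι] {S : Matrix ι ι ℝ} {ν a : ℝ}
    (ha : 0 < a) (hS : S.PosDef) (m : ι → ℝ) :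
    (studentT ν 0 S).map (fun r => m + a • r) = studentT ν m ((a ^ 2) • S) := by
  refine Measure.ext_of_lintegral _ fun g hg => ?_
  rw [lintegral_map hg (by fun_prop), studentT, studentT,
    lintegral_withDensity_eq_lintegral_mul _ (by fun_prop) hg,
    lintegral_withDensity_eq_lintegral_mul _ (by fun_prop) (by fun_prop),
    eq_comm, lintegral_eq_lintegral_add_smul ha m (by fun_prop),
    ← lintegral_const_mul' _ _ ENNReal.ofReal_ne_top]
  refine lintegral_congr fun r => ?_
  simp only [Pi.mul_apply]
  rw [← studentTPDF_add_smul ha hS m r, ENNReal.ofReal_mul (by positivity), mul_assoc]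

lemma isOpenPosMeasure_studentT {ι : Type*} [Fintype ι] [DecidableEq ι] {S : Matrix ι ι ℝ} {ν : ℝ}
    (hν : 0 < ν) (hS : S.PosDef) (m : ι → ℝ) : (studentT ν m S).IsOpenPosMeasure := by
  refine (withDensity_absolutelyContinuous' (μ := volume) ?_ ?_).isOpenPosMeasure
  · fun_prop
  · exact ae_of_all _ fun y => by simpa using studentTPDF_pos hν hS m y

/-! ### Law and conditional law of the residual -/

section Residual

variable {Ω : Type*} [MeasurableSpace Ω] {P : Measure Ω} {d : ℕ}
  {j : Fin d} {ν : ℝ} {S : Matrix (Fin d) (Fin d) ℝ} {Y : Ω → Fin d → ℝ}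

/-- The map `y ↦ (y j, residual)` undoes `ofResidual`, so it recovers the product measure; its
marginals and conditional laws give part (i). -/
lemma map_coord_residual (hν : 0 < ν) (hS : IsCorrelationMatrix S)
    (hY : HasLaw Y (studentT ν 0 S) P) (j : Fin d) :
    P.map (fun ω => (Y ω j, standardizedResidual ν S j (Y ω)))
      = (univStudentT ν).prod (studentT (ν + 1) 0 (partialMatrix S j)) := by
  have hg : Measurable fun y : Fin d → ℝ => (y j, standardizedResidual ν S j y) := by fun_prop
  have : (fun ω => (Y ω j, standardizedResidual ν S j (Y ω)))
      = (fun y : Fin d → ℝ => (y j, standardizedResidual ν S j y)) ∘ Y := rfl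
  rw [this, ← AEMeasurable.map_map_of_aemeasurable hg.aemeasurable hY.aemeasurable, hY.map_eq,
    studentT_eq_map_ofResidual hν hS j, Measure.map_map hg (by fun_prop)]
  convert Measure.map_id
  ext1 p
  simp [standardizedResidual_ofResidual hν]

lemma map_coord [IsProbabilityMeasure P] (hν : 0 < ν) (hS : IsCorrelationMatrix S)
    (hY : HasLaw Y (studentT ν 0 S) P) (j : Fin d) :
    P.map (fun ω => Y ω j) = univStudentT ν := by
  have := hY.isProbabilityMeasure_iff.1 inferInstance
  have := isProbabilityMeasure_studentT_partialMatrix hν hS j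
  have hYm := hY.aemeasurable
  have h := congrArg Measure.fst (map_coord_residual hν hS hY j)
  rwa [Measure.fst_prod, Measure.fst_map_prodMk₀ (by fun_prop)] at h

lemma hasLaw_standardizedResidual (hν : 0 < ν) (hS : IsCorrelationMatrix S)
    (hY : HasLaw Y (studentT ν 0 S) P) (j : Fin d) :
    HasLaw (fun ω => standardizedResidual ν S j (Y ω))
      (studentT (ν + 1) 0 (partialMatrix S j)) P := by
  have hYm := hY.aemeasurable
  refine ⟨by fun_prop, ?_⟩
  have := isProbabilityMeasure_univStudentT hν
  have h := congrArg Measure.snd (map_coord_residual hν hS hY j)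
  have : SFinite (studentT (ν + 1) 0 (partialMatrix S j)) := by
    unfold studentT
    infer_instance
  rwa [Measure.snd_prod, Measure.snd_map_prodMk₀ (by fun_prop)] at h

lemma condDistrib_standardizedResidual [IsProbabilityMeasure P] (hν : 0 < ν)
    (hS : IsCorrelationMatrix S) (hY : HasLaw Y (studentT ν 0 S) P) (j : Fin d) :
    ∀ᵐ y ∂(P.map (fun ω => Y ω j)),
      condDistrib (fun ω => standardizedResidual ν S j (Y ω)) (fun ω => Y ω j) P y
        = studentT (ν + 1) 0 (partialMatrix S j) := by
  have := hY.isProbabilityMeasure_iff.1 inferInstance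
  have := isProbabilityMeasure_studentT_partialMatrix hν hS j
  have := isProbabilityMeasure_univStudentT hν
  have hYm := hY.aemeasurable
  have h := condDistrib_ae_eq_of_measure_eq_compProd (μ := P) (fun ω => Y ω j)
    (Y := fun ω => standardizedResidual ν S j (Y ω)) (by fun_prop)
    (κ := Kernel.const ℝ (studentT (ν + 1) 0 (partialMatrix S j)))
    (by rw [map_coord_residual hν hS hY, map_coord hν hS hY, Measure.compProd_const])
  filter_upwards [h] with y hy
  rw [hy, Kernel.const_apply]

end Residual

/-! ### Pareto tail of the univariate Student distribution -/

noncomputable section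

/-- The tail constant of the univariate Student distribution. -/
def studentTTailConst (ν : ℝ) : ℝ :=
  studentTConst ν (1 : Matrix (Fin 1) (Fin 1) ℝ) * ν ^ ((ν - 1) / 2)

/-- The ratio of the univariate Student density and its Pareto asymptote. -/
def paretoRatio (ν y : ℝ) : ℝ := (1 + ν / y ^ 2) ^ (-(ν + 1) / 2)

end

section Tail

variable {ν : ℝ}

lemma studentTTailConst_pos (hν : 0 < ν) : 0 < studentTTailConst ν :=
  mul_pos (studentTConst_one_pos hν) (by positivity)

@[fun_prop]
lemma measurable_paretoRatio : Measurable (paretoRatio ν) := by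
  unfold paretoRatio
  fun_prop

lemma paretoRatio_nonneg (hν : 0 < ν) (y : ℝ) : 0 ≤ paretoRatio ν y := by
  unfold paretoRatio
  positivity

lemma paretoRatio_le_one (hν : 0 < ν) (y : ℝ) : paretoRatio ν y ≤ 1 := by
  refine Real.rpow_le_one_of_one_le_of_nonpos ?_ (by linarith)
  have : 0 ≤ ν / y ^ 2 := by positivity
  linarith

lemma tendsto_paretoRatio (ν : ℝ) : Tendsto (paretoRatio ν) atTop (nhds 1) := by
  have h1 : Tendsto (fun y : ℝ => 1 + ν / y ^ 2) atTop (nhds (1 + 0)) :=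
    tendsto_const_nhds.add (tendsto_const_nhds.div_atTop (tendsto_pow_atTop two_ne_zero))
  have h2 := h1.rpow_const (p := -(ν + 1) / 2) (by simp)
  rwa [add_zero, Real.one_rpow] at h2

lemma univStudentTPDF_eq (hν : 0 < ν) {y : ℝ} (hy : 0 < y) :
    univStudentTPDF ν y = studentTTailConst ν * (ν * y ^ (-(ν + 1))) * paretoRatio ν y := by
  have e1 : 1 + y ^ 2 / ν = y ^ 2 / ν * (1 + ν / y ^ 2) := by field_simp; ring
  have e2 : (y ^ 2) ^ (-(ν + 1) / 2) = y ^ (-(ν + 1)) := by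
    rw [← Real.rpow_natCast, ← Real.rpow_mul hy.le]
    congr 1
    push_cast
    ring
  have e3 : (ν ^ (-(ν + 1) / 2))⁻¹ = ν ^ ((ν - 1) / 2) * ν := by
    rw [← Real.rpow_neg hν.le]
    conv_rhs => rw [← Real.rpow_add_one hν.ne']
    congr 1
    ring
  rw [univStudentTPDF, studentTTailConst, paretoRatio, e1,
    Real.mul_rpow (by positivity) (by positivity), Real.div_rpow (by positivity) hν.le, e2,
    div_eq_mul_inv, e3]
  ring

lemma measurable_paretoPDF (t r : ℝ) : Measurable (paretoPDF t r) := by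
  unfold paretoPDF
  fun_prop

lemma univStudentT_restrict_Ioi (hν : 0 < ν) {u : ℝ} (hu : 0 < u) :
    (univStudentT ν).restrict (Set.Ioi u) = ENNReal.ofReal (studentTTailConst ν * u ^ (-ν)) •
      (paretoMeasure u ν).withDensity (fun y => ENNReal.ofReal (paretoRatio ν y)) := by
  have hK := studentTTailConst_pos hν
  have hm := measurable_paretoPDF u ν
  rw [univStudentT, paretoMeasure, restrict_withDensity measurableSet_Ioi,
    Measure.restrict_congr_set Ioi_ae_eq_Ici, ← withDensity_indicator measurableSet_Ici,
    ← withDensity_mul _ hm (by fun_prop), ← withDensity_smul _ (by fun_prop)]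
  congr 1
  ext y
  by_cases hy : u ≤ y
  · have hy0 : 0 < y := hu.trans_le hy
    simp only [Set.mem_Ici, hy, Set.indicator_of_mem, Pi.smul_apply, Pi.mul_apply, smul_eq_mul,
      paretoPDF_of_le hy]
    rw [← ENNReal.ofReal_mul (by positivity), ← ENNReal.ofReal_mul (by positivity),
      univStudentTPDF_eq hν hy0, Real.rpow_neg hu.le]
    congr 1
    have : 0 < u ^ ν := by positivity
    field_simp
  · simp [hy, paretoPDF_of_lt (not_le.1 hy)]

/-- Scaling moves the threshold from the measure into the integrand, leaving one fixed measure for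
dominated convergence. -/
lemma map_mul_paretoMeasure {u : ℝ} (hu : 0 < u) :
    (paretoMeasure 1 ν).map (fun s => u * s) = paretoMeasure u ν := by
  have hm := measurable_paretoPDF u ν
  have hm1 := measurable_paretoPDF 1 ν
  refine Measure.ext_of_lintegral _ fun g hg => ?_
  rw [lintegral_map hg (by fun_prop), paretoMeasure, paretoMeasure,
    lintegral_withDensity_eq_lintegral_mul _ hm1 (by fun_prop),
    lintegral_withDensity_eq_lintegral_mul _ hm hg, eq_comm]
  conv_lhs => rw [← Real.smul_map_volume_mul_left hu.ne']
  rw [lintegral_smul_measure, lintegral_map (by fun_prop) (by fun_prop), smul_eq_mul,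
    ← lintegral_const_mul' _ _ ENNReal.ofReal_ne_top]
  refine lintegral_congr fun s => ?_
  simp only [Pi.mul_apply]
  rw [← mul_assoc]
  congr 1
  by_cases hs : 1 ≤ s
  · have hs0 : 0 < s := one_pos.trans_le hs
    rw [paretoPDF_of_le hs, paretoPDF_of_le (le_mul_of_one_le_right hu.le hs),
      ← ENNReal.ofReal_mul (by positivity), abs_of_pos hu, Real.mul_rpow hu.le hs0.le,
      Real.rpow_neg hu.le, Real.rpow_add hu, Real.rpow_one, Real.one_rpow]
    congr 1
    have : 0 < u ^ ν := by positivity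
    field_simp
  · rw [paretoPDF_of_lt (not_le.1 hs), paretoPDF_of_lt, mul_zero]
    nlinarith [not_le.1 hs]

lemma ae_one_le_paretoMeasure : ∀ᵐ s ∂(paretoMeasure 1 ν), 1 ≤ s := by
  rw [paretoMeasure, ae_withDensity_iff (measurable_paretoPDF 1 ν)]
  refine ae_of_all _ fun s hs => ?_
  by_contra h
  exact hs (paretoPDF_of_lt (not_le.1 h))

lemma paretoMeasure_Ioi (hν : 0 < ν) {a : ℝ} (ha : 1 ≤ a) :
    paretoMeasure 1 ν (Set.Ioi a) = ENNReal.ofReal (a ^ (-ν)) := by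
  have ha0 : 0 < a := one_pos.trans_le ha
  rw [paretoMeasure, withDensity_apply _ measurableSet_Ioi,
    setLIntegral_congr_fun measurableSet_Ioi
      (fun x hx => paretoPDF_of_le (r := ν) (ha.trans (le_of_lt (Set.mem_Ioi.1 hx)))),
    ← ofReal_integral_eq_lintegral_ofReal]
  · rw [integral_const_mul, integral_Ioi_rpow_of_lt (by linarith) ha0]
    congr 1
    simp
    field_simp
  · exact (integrableOn_Ioi_rpow_of_lt (by linarith) ha0).const_mul _
  · filter_upwards [ae_restrict_mem measurableSet_Ioi] with x hx
    have : 0 < x := ha0.trans hx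
    positivity

lemma map_log_paretoMeasure (hν : 0 < ν) :
    (paretoMeasure 1 ν).map (fun s => ν * Real.log s) = expMeasure 1 := by
  have h1 := isProbabilityMeasure_paretoMeasure one_pos hν
  have h2 := isProbabilityMeasure_expMeasure one_pos
  have hm : Measurable fun s => ν * Real.log s := by fun_prop
  have h3 := Measure.isProbabilityMeasure_map (μ := paretoMeasure 1 ν) hm.aemeasurable
  refine Measure.eq_of_cdf _ _ ?_
  ext x
  rw [cdf_expMeasure_eq one_pos, cdf_eq_real, map_measureReal_apply hm measurableSet_Iic]
  split_ifs with hx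
  · have hset : (fun s => ν * Real.log s) ⁻¹' Set.Iic x
        =ᵐ[paretoMeasure 1 ν] ((Set.Ioi (Real.exp (x / ν)))ᶜ : Set ℝ) := by
      filter_upwards [ae_one_le_paretoMeasure] with s hs
      have hs0 : 0 < s := one_pos.trans_le hs
      refine propext ?_
      change ν * Real.log s ≤ x ↔ ¬ (Real.exp (x / ν) < s)
      rw [not_lt, ← Real.log_le_iff_le_exp hs0, le_div_iff₀' hν]
    rw [measureReal_congr hset, probReal_compl_eq_one_sub measurableSet_Ioi, measureReal_def,
      paretoMeasure_Ioi hν (Real.one_le_exp (by positivity)),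
      ENNReal.toReal_ofReal (by positivity), ← Real.exp_mul]
    congr 2
    field_simp
  · rw [measureReal_def, ENNReal.toReal_eq_zero_iff]
    left
    rw [← nonpos_iff_eq_zero]
    refine (measure_mono ?_).trans (ae_iff.1 (ae_one_le_paretoMeasure (ν := ν))).le
    intro s hs h
    have := Real.log_nonneg h
    have h4 : ν * Real.log s ≤ x := hs
    have : 0 ≤ ν * Real.log s := by positivity
    linarith

variable {α : Type*} [MeasurableSpace α] {μ : Measure α}

lemma integral_univStudentT_restrict_Ioi_prod [SFinite μ] (hν : 0 < ν) {u : ℝ} (hu : 0 < u)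
    {G : ℝ × α → ℝ} (hG : Measurable G) :
    ∫ p, G p ∂(((univStudentT ν).restrict (Set.Ioi u)).prod μ)
      = studentTTailConst ν * u ^ (-ν) *
        ∫ p, paretoRatio ν (u * p.1) * G (u * p.1, p.2) ∂((paretoMeasure 1 ν).prod μ) := by
  have h1 := isProbabilityMeasure_paretoMeasure one_pos hν
  have h2 := isProbabilityMeasure_paretoMeasure hu hν
  have hK := studentTTailConst_pos hν
  have hmap : (paretoMeasure u ν).prod μ
      = ((paretoMeasure 1 ν).prod μ).map (Prod.map (fun s => u * s) id) := by
    rw [← Measure.map_prod_map _ _ (by fun_prop) measurable_id, map_mul_paretoMeasure hu,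
      Measure.map_id]
  rw [univStudentT_restrict_Ioi hν hu, Measure.prod_smul_left, prod_withDensity_left (by fun_prop),
    integral_smul_measure, integral_withDensity_eq_integral_toReal_smul (by fun_prop)
      (ae_of_all _ fun _ => ENNReal.ofReal_lt_top), hmap, integral_map (by fun_prop),
    ENNReal.toReal_ofReal (by positivity), smul_eq_mul]
  · simp only [Prod.map_fst, smul_eq_mul, ENNReal.toReal_ofReal (paretoRatio_nonneg hν _)]
    rfl
  · exact Measurable.aestronglyMeasurable (by fun_prop)

/-- Exceedances of a univariate Student variable, rescaled by the threshold, are asymptotically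
Pareto distributed. -/
lemma tendsto_rpow_mul_integral_Ioi [IsProbabilityMeasure μ] (hν : 0 < ν) {β : Type*}
    {l : Filter β} [l.IsCountablyGenerated] {u : β → ℝ} (hu : Tendsto u l atTop)
    {G : β → ℝ × α → ℝ} (hG : ∀ t, Measurable (G t)) {C : ℝ} (hC : ∀ t p, |G t p| ≤ C)
    {g : ℝ × α → ℝ}
    (hg : ∀ p : ℝ × α, 1 ≤ p.1 → Tendsto (fun t => G t (u t * p.1, p.2)) l (nhds (g p))) :
    Tendsto (fun t => u t ^ ν * ∫ p, G t p ∂(((univStudentT ν).restrict (Set.Ioi (u t))).prod μ)) l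
      (nhds (studentTTailConst ν * ∫ p, g p ∂((paretoMeasure 1 ν).prod μ))) := by
  have h1 := isProbabilityMeasure_paretoMeasure one_pos hν
  have hae : ∀ᵐ p ∂((paretoMeasure 1 ν).prod μ), 1 ≤ p.1 :=
    Measure.quasiMeasurePreserving_fst.ae ae_one_le_paretoMeasure
  have key : Tendsto (fun t => ∫ p, paretoRatio ν (u t * p.1) * G t (u t * p.1, p.2)
      ∂((paretoMeasure 1 ν).prod μ)) l (nhds (∫ p, g p ∂((paretoMeasure 1 ν).prod μ))) := by
    refine tendsto_integral_filter_of_dominated_convergence (fun _ => C) ?_ ?_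
      (integrable_const _) ?_
    · refine Eventually.of_forall fun t => Measurable.aestronglyMeasurable ?_
      have := hG t
      fun_prop
    · refine Eventually.of_forall fun t => ae_of_all _ fun p => ?_
      rw [Real.norm_eq_abs, abs_mul, abs_of_nonneg (paretoRatio_nonneg hν _)]
      exact (mul_le_of_le_one_left (abs_nonneg _) (paretoRatio_le_one hν _)).trans (hC _ _)
    · filter_upwards [hae] with p hp
      have h2 : Tendsto (fun t => u t * p.1) l atTop := hu.atTop_mul_const (one_pos.trans_le hp)
      simpa using ((tendsto_paretoRatio ν).comp h2).mul (hg p hp)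
  refine (key.const_mul (studentTTailConst ν)).congr' ?_
  filter_upwards [hu.eventually_gt_atTop 0] with t ht
  rw [integral_univStudentT_restrict_Ioi_prod hν ht (hG t), Real.rpow_neg ht.le]
  have : 0 < u t ^ ν := by positivity
  field_simp

lemma tendsto_rpow_mul_univStudentT_Ioi (hν : 0 < ν) :
    Tendsto (fun u => u ^ ν * (univStudentT ν).real (Set.Ioi u)) atTop
      (nhds (studentTTailConst ν)) := by
  have h1 := isProbabilityMeasure_paretoMeasure one_pos hν
  have h2 := isProbabilityMeasure_univStudentT hν
  -- A one-point second factor and a constant integrand reduce the product statement to the tail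
  -- itself.
  have := tendsto_rpow_mul_integral_Ioi (μ := Measure.dirac ()) hν tendsto_id
    (G := fun _ _ => 1) (fun _ => measurable_const) (C := 1) (by simp) (g := fun _ => 1)
    (fun _ _ => tendsto_const_nhds)
  simpa [measureReal_def, Measure.prod_apply] using this

end Tail

/-! ### Transformation to an exponential tail -/

noncomputable section

/-- The map `w ↦ ν log w`, extended by `-∞` to `w ≤ 0`. -/
def scaledLog (ν w : ℝ) : EReal := if 0 < w then ((ν * Real.log w : ℝ) : EReal) else ⊥

end

@[fun_prop]
lemma measurable_scaledLog (ν : ℝ) : Measurable (scaledLog ν) := by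
  refine Measurable.ite measurableSet_Ioi ?_ measurable_const
  exact measurable_coe_real_ereal.comp (by fun_prop)

/-- For w ≤ 0 both sides hold, so no sign condition on w is needed. -/
lemma scaledLog_le_coe_iff {ν : ℝ} (hν : 0 < ν) {w z : ℝ} :
    scaledLog ν w ≤ z ↔ w ≤ Real.exp (z / ν) := by
  unfold scaledLog
  split_ifs with hw
  · rw [EReal.coe_le_coe_iff, ← Real.log_le_iff_le_exp hw, le_div_iff₀' hν]
  · simp [(not_lt.1 hw).trans (Real.exp_pos _).le]

lemma scaledLog_ne_top (ν w : ℝ) : scaledLog ν w ≠ ⊤ := by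
  unfold scaledLog
  split_ifs
  · exact EReal.coe_ne_top _
  · exact bot_ne_top

lemma scaledLog_eq_bot_iff {ν w : ℝ} : scaledLog ν w = ⊥ ↔ w ≤ 0 := by
  unfold scaledLog
  split_ifs with h
  · exact iff_of_false (EReal.coe_ne_bot _) h.not_ge
  · simpa using h

section ExponentialMargin

variable {m : Measure ℝ} {ν K : ℝ} {T : ℝ → ℝ}

lemma tendsto_exp_mul_of_isEquivalent {f : ℝ → ℝ}
    (hf : f ~[atTop] (fun x : ℝ => Real.exp (-x))) :
    Tendsto (fun x => Real.exp x * f x) atTop (nhds 1) := by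
  have := (isEquivalent_iff_tendsto_one (Eventually.of_forall fun x => (Real.exp_pos _).ne')).1 hf
  refine this.congr fun x => ?_
  simp [Real.exp_neg, mul_comm]

lemma measureReal_lt_pos [IsFiniteMeasure m]
    (hT : Tendsto (fun x => Real.exp x * m.real {y | x < T y}) atTop (nhds 1)) (x : ℝ) :
    0 < m.real {y | x < T y} := by
  obtain ⟨z, hz, hxz⟩ := ((hT.eventually (lt_mem_nhds one_pos)).and (eventually_ge_atTop x)).exists
  have h1 : 0 < m.real {y | z < T y} := pos_of_mul_pos_right hz (Real.exp_pos _).le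
  exact h1.trans_le (measureReal_mono fun y (hy : z < T y) => hxz.trans_lt hy)

lemma tendsto_atTop_of_measureReal_lt [IsFiniteMeasure m] (hmono : Monotone T)
    (hT : Tendsto (fun x => Real.exp x * m.real {y | x < T y}) atTop (nhds 1)) :
    Tendsto T atTop atTop := by
  refine tendsto_atTop_atTop_of_monotone hmono fun b => ?_
  by_contra! h
  have h1 := measureReal_lt_pos hT b
  have : {y | b < T y} = ∅ := by
    ext y
    simpa using (h y).le
  simp [this] at h1

/-- The law of T may have atoms. The weak level set at x lies in the strict one at x - ε, which
costs a factor e^ε arbitrarily close to 1. -/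
lemma tendsto_exp_mul_measureReal_le [IsFiniteMeasure m]
    (hT : Tendsto (fun x => Real.exp x * m.real {y | x < T y}) atTop (nhds 1)) :
    Tendsto (fun x => Real.exp x * m.real {y | x ≤ T y}) atTop (nhds 1) := by
  refine tendsto_order.2 ⟨fun a ha => ?_, fun a ha => ?_⟩
  · filter_upwards [hT.eventually (lt_mem_nhds ha)] with x hx
    refine hx.trans_le (mul_le_mul_of_nonneg_left ?_ (Real.exp_pos _).le)
    exact measureReal_mono fun y (hy : x < T y) => hy.le
  · set ε := Real.log a / 2 with hε
    have hε0 : 0 < ε := half_pos (Real.log_pos ha)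
    have h1 : Tendsto (fun x => Real.exp ε * (Real.exp (x - ε) * m.real {y | x - ε < T y})) atTop
        (nhds (Real.exp ε * 1)) :=
      (hT.comp (tendsto_atTop_add_const_right _ (-ε) tendsto_id)).const_mul _
    have h2 : Real.exp ε * 1 < a := by
      rw [mul_one, ← Real.lt_log_iff_exp_lt (by linarith)]
      linarith
    filter_upwards [h1.eventually (gt_mem_nhds h2)] with x hx
    refine lt_of_le_of_lt ?_ hx
    rw [← mul_assoc, ← Real.exp_add, add_sub_cancel]
    refine mul_le_mul_of_nonneg_left ?_ (Real.exp_pos _).le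
    exact measureReal_mono fun y (hy : x ≤ T y) => by
      change x - ε < T y
      linarith

/-- Monotonicity alone gives {T > T u} ⊆ (u, ∞) ⊆ {T ≥ T u}, so T need be neither continuous nor
strictly increasing. -/
lemma tendsto_exp_mul_measureReal_Ioi [IsFiniteMeasure m] (hmono : Monotone T)
    (hT : Tendsto (fun x => Real.exp x * m.real {y | x < T y}) atTop (nhds 1)) :
    Tendsto (fun u => Real.exp (T u) * m.real (Set.Ioi u)) atTop (nhds 1) := by
  have h := tendsto_atTop_of_measureReal_lt hmono hT
  refine tendsto_of_tendsto_of_tendsto_of_le_of_le (hT.comp h)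
    ((tendsto_exp_mul_measureReal_le hT).comp h) (fun u => ?_) (fun u => ?_)
  · refine mul_le_mul_of_nonneg_left (measureReal_mono fun y hy => ?_) (Real.exp_pos _).le
    exact hmono.reflect_lt hy
  · refine mul_le_mul_of_nonneg_left (measureReal_mono fun y hy => ?_) (Real.exp_pos _).le
    exact hmono (le_of_lt hy)

/-- The tail mass q cancels in the quotient of the two limits; then take logarithms. It serves both
for a = T(u) and for the level a = t with threshold u(t). -/
lemma tendsto_sub_mul_log {β : Type*} {l : Filter β} {a q u : β → ℝ} (hK : 0 < K)
    (hu : Tendsto u l atTop) (ha : Tendsto (fun t => Real.exp (a t) * q t) l (nhds 1))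
    (hq : Tendsto (fun t => u t ^ ν * q t) l (nhds K)) :
    Tendsto (fun t => a t - ν * Real.log (u t)) l (nhds (-Real.log K)) := by
  have h1 := (ha.div hq hK.ne').log (by simpa using hK.ne')
  rw [one_div, Real.log_inv] at h1
  refine h1.congr' ?_
  filter_upwards [hu.eventually_gt_atTop 0, hq.eventually (lt_mem_nhds hK)] with t ht hqt
  have h2 : q t ≠ 0 := by
    rintro h
    simp [h] at hqt
  simp only [Pi.div_apply]
  rw [mul_div_mul_right _ _ h2, Real.log_div (Real.exp_pos _).ne' (by positivity), Real.log_exp,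
    Real.log_rpow ht]

lemma tendsto_quantile_transform [IsFiniteMeasure m] (hmono : Monotone T) (hK : 0 < K)
    (hm : Tendsto (fun u => u ^ ν * m.real (Set.Ioi u)) atTop (nhds K))
    (hT : Tendsto (fun x => Real.exp x * m.real {y | x < T y}) atTop (nhds 1)) :
    Tendsto (fun u => T u - ν * Real.log u) atTop (nhds (-Real.log K)) :=
  tendsto_sub_mul_log hK tendsto_id (tendsto_exp_mul_measureReal_Ioi hmono hT) hm

lemma isEquivalent_rightInverse (hν : 0 < ν) (hmono : Monotone T) (hK : 0 < K)
    (hlog : Tendsto (fun u => T u - ν * Real.log u) atTop (nhds (-Real.log K)))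
    {Tinv : ℝ → ℝ} (hinv : ∀ᶠ x in atTop, T (Tinv x) = x) :
    Tinv ~[atTop] (fun x : ℝ => K ^ (1 / ν) * Real.exp (x / ν)) := by
  have htop : Tendsto Tinv atTop atTop := by
    refine tendsto_atTop.2 fun M => ?_
    filter_upwards [hinv, eventually_gt_atTop (T M)] with x hx hM
    exact (hmono.reflect_lt (hM.trans_eq hx.symm)).le
  have h1 : Tendsto (fun x => x - ν * Real.log (Tinv x)) atTop (nhds (-Real.log K)) := by
    refine (hlog.comp htop).congr' ?_
    filter_upwards [hinv] with x hx
    simp [hx]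
  rw [isEquivalent_iff_tendsto_one (Eventually.of_forall fun x => by positivity)]
  have h2 : Tendsto (fun x => Real.exp (-((x - ν * Real.log (Tinv x)) + Real.log K) / ν)) atTop
      (nhds (Real.exp (-(-Real.log K + Real.log K) / ν))) :=
    (Real.continuous_exp.tendsto _).comp (((h1.add_const _).neg).div_const _)
  simp only [neg_add_cancel, neg_zero, zero_div, Real.exp_zero] at h2
  refine h2.congr' ?_
  filter_upwards [htop.eventually_gt_atTop 0] with x hx
  simp only [Pi.div_apply]
  rw [Real.rpow_def_of_pos hK, ← Real.exp_add]
  nth_rewrite 2 [← Real.exp_log hx]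
  rw [← Real.exp_sub]
  congr 1
  field_simp
  ring

lemma tendsto_sub_of_dilation
    (hlog : Tendsto (fun u => T u - ν * Real.log u) atTop (nhds (-Real.log K)))
    {β : Type*} {l : Filter β} {v a : β → ℝ} (hv : Tendsto v l atTop)
    (ha : Tendsto (fun t => a t - ν * Real.log (v t)) l (nhds (-Real.log K)))
    {c : ℝ} (hc : 0 < c) :
    Tendsto (fun t => T (v t * c) - a t) l (nhds (ν * Real.log c)) := by
  have h1 := ((hlog.comp (hv.atTop_mul_const hc)).sub ha).add_const (ν * Real.log c)
  rw [sub_self, zero_add] at h1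
  refine h1.congr' ?_
  filter_upwards [hv.eventually_gt_atTop 0] with t ht
  simp only [Function.comp_apply]
  rw [Real.log_mul ht.ne' hc.ne']
  ring

/-- By monotonicity, y is compared with the dilations v e^{b/ν}, along which the increment of T
tends to b. This also covers w ≤ 0, where y need not diverge and the expansion of T is unavailable.
-/
lemma tendsto_coe_sub_scaledLog (hν : 0 < ν) (hmono : Monotone T)
    (hlog : Tendsto (fun u => T u - ν * Real.log u) atTop (nhds (-Real.log K)))
    {β : Type*} {l : Filter β} {v y : β → ℝ} (hv : Tendsto v l atTop) {w : ℝ}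
    (hy : Tendsto (fun t => y t / v t) l (nhds w)) :
    Tendsto (fun t => ((T (y t) - T (v t) : ℝ) : EReal)) l (nhds (scaledLog ν w)) := by
  have hdil (b : ℝ) : Tendsto (fun t => T (v t * Real.exp (b / ν)) - T (v t)) l (nhds b) := by
    convert tendsto_sub_of_dilation hlog hv (hlog.comp hv) (Real.exp_pos (b / ν)) using 2
    rw [Real.log_exp]
    field_simp
  refine tendsto_order.2 ⟨fun b hb => ?_, fun b hb => ?_⟩
  · obtain ⟨b', hb1, hb2⟩ := EReal.lt_iff_exists_real_btwn.1 hb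
    have hw : Real.exp (b' / ν) < w := by
      by_contra! h
      exact hb2.not_ge ((scaledLog_le_coe_iff hν).2 h)
    obtain ⟨b'', hb3, hb4⟩ := EReal.lt_iff_exists_real_btwn.1 hb1
    filter_upwards [hy.eventually (lt_mem_nhds hw), hv.eventually_gt_atTop 0,
      (hdil b').eventually (lt_mem_nhds (EReal.coe_lt_coe_iff.1 hb4))] with t h1 h2 h3
    refine hb3.trans (EReal.coe_lt_coe_iff.2 (h3.trans_le (sub_le_sub_right (hmono ?_) _)))
    rw [lt_div_iff₀ h2] at h1
    linarith
  · obtain ⟨b', hb1, hb2⟩ := EReal.lt_iff_exists_real_btwn.1 hb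
    obtain ⟨b'', hb3, hb4⟩ := EReal.lt_iff_exists_real_btwn.1 hb1
    have hw : w < Real.exp (b' / ν) :=
      lt_of_le_of_lt ((scaledLog_le_coe_iff hν).1 hb3.le)
        (Real.exp_lt_exp.2 (div_lt_div_of_pos_right (EReal.coe_lt_coe_iff.1 hb4) hν))
    obtain ⟨c, hc1, hc2⟩ := EReal.lt_iff_exists_real_btwn.1 hb2
    filter_upwards [hy.eventually (gt_mem_nhds hw), hv.eventually_gt_atTop 0,
      (hdil b').eventually (gt_mem_nhds (EReal.coe_lt_coe_iff.1 hc1))] with t h1 h2 h3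
    refine lt_trans (EReal.coe_lt_coe_iff.2 (lt_of_le_of_lt (sub_le_sub_right (hmono ?_) _) h3)) hc2
    rw [div_lt_iff₀ h2] at h1
    linarith

/-- Up to null sets, the upper level sets of `T` are half-lines with diverging end points. -/
lemma exists_threshold (hmono : Monotone T) (htop : Tendsto T atTop atTop) [NullSingletonClass m] :
    ∃ u : ℝ → ℝ, Tendsto u atTop atTop ∧
      ∀ᶠ t in atTop, {y | t < T y} =ᵐ[m] Set.Ioi (u t) := by
  have hne (t : ℝ) : {y | t < T y}.Nonempty := (htop.eventually_gt_atTop t).exists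
  have hbdd {t M : ℝ} (h : T M < t) : M ∈ lowerBounds {y | t < T y} := fun y hy =>
    (hmono.reflect_lt (h.trans hy)).le
  refine ⟨fun t => sInf {y | t < T y}, tendsto_atTop.2 fun M => ?_, ?_⟩
  · filter_upwards [eventually_gt_atTop (T M)] with t ht
    exact le_csInf (hne t) (hbdd ht)
  -- For t > T 0 the level set is bounded below by 0, so its `sInf` is a genuine infimum.
  · filter_upwards [eventually_gt_atTop (T 0)] with t ht
    have h1 : Set.Ioi (sInf {y | t < T y}) ⊆ {y | t < T y} := fun y hy => by
      obtain ⟨z, hz, hzy⟩ := exists_lt_of_csInf_lt (hne t) hy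
      exact lt_of_lt_of_le hz (hmono hzy.le)
    have h2 : {y | t < T y} ⊆ Set.Ici (sInf {y | t < T y}) := fun y hy =>
      csInf_le ⟨0, hbdd ht⟩ hy
    exact (h2.eventuallyLE.trans Ioi_ae_eq_Ici.symm.le).antisymm h1.eventuallyLE

end ExponentialMargin

/-! ### The conditional limit -/

noncomputable section

/-- The limiting log-ratios as a function of the standardized residual. -/
def spectralLimit {d : ℕ} (ν : ℝ) (S : Matrix (Fin d) (Fin d) ℝ) (j : Fin d)
    (r : {k : Fin d // k ≠ j} → ℝ) : Fin d → EReal :=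
  fun k => if h : k ≠ j then
    scaledLog ν (columnWithout S j ⟨k, h⟩ + 1 / √(ν + 1) * r ⟨k, h⟩) else 0

/-- The increments of `T` from the `j`-th coordinate, and the excess of the latter over `t`. -/
def marginIncrements {d : ℕ} (T : ℝ → ℝ) (j : Fin d) (t : ℝ) (y : Fin d → ℝ) :
    (Fin d → EReal) × ℝ :=
  (fun k => ((T (y k) - T (y j) : ℝ) : EReal), T (y j) - t)

end

section Limit

variable {d : ℕ} {S : Matrix (Fin d) (Fin d) ℝ} {j : Fin d} {ν K : ℝ} {T : ℝ → ℝ}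

@[simp]
lemma spectralLimit_self (r : {k : Fin d // k ≠ j} → ℝ) : spectralLimit ν S j r j = 0 := by
  simp [spectralLimit]

@[simp]
lemma spectralLimit_coe (r : {k : Fin d // k ≠ j} → ℝ) (k : {k : Fin d // k ≠ j}) :
    spectralLimit ν S j r k = scaledLog ν (columnWithout S j k + 1 / √(ν + 1) * r k) := by
  simp [spectralLimit, k.2]

@[fun_prop]
lemma measurable_spectralLimit : Measurable (spectralLimit ν S j) := by
  refine measurable_pi_lambda _ fun k => ?_
  by_cases h : k = j
  · simp [spectralLimit, h]
  · simp only [spectralLimit, ne_eq, h, not_false_eq_true, dite_true]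
    fun_prop

lemma spectralLimit_ne_top (r : {k : Fin d // k ≠ j} → ℝ) (k : Fin d) :
    spectralLimit ν S j r k ≠ ⊤ := by
  unfold spectralLimit
  split_ifs
  · exact scaledLog_ne_top _ _
  · exact EReal.zero_ne_top

lemma measurable_marginIncrements (hT : Measurable T) (j : Fin d) (t : ℝ) :
    Measurable (marginIncrements T j t) := by
  unfold marginIncrements
  refine Measurable.prodMk (measurable_pi_lambda _ fun k => measurable_coe_real_ereal.comp ?_) ?_ <;>
  fun_prop

lemma tendsto_sqrt_add_sq_div (ν : ℝ) :
    Tendsto (fun v : ℝ => √(ν + v ^ 2) / v) atTop (nhds 1) := by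
  have h1 : Tendsto (fun v : ℝ => √(ν / v ^ 2 + 1)) atTop (nhds (√(0 + 1))) :=
    ((tendsto_const_nhds.div_atTop (tendsto_pow_atTop two_ne_zero)).add_const 1).sqrt
  rw [zero_add, Real.sqrt_one] at h1
  refine h1.congr' ?_
  filter_upwards [eventually_gt_atTop 0] with v hv
  have h2 : ν / v ^ 2 + 1 = (ν + v ^ 2) / v ^ 2 := by field_simp
  rw [h2, Real.sqrt_div' _ (by positivity), Real.sqrt_sq hv.le]

lemma tendsto_ofResidual_div (r : {k : Fin d // k ≠ j} → ℝ) (k : {k : Fin d // k ≠ j}) :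
    Tendsto (fun v : ℝ => ofResidual ν S j (v, r) k / v) atTop
      (nhds (columnWithout S j k + 1 / √(ν + 1) * r k)) := by
  have h := (((tendsto_sqrt_add_sq_div ν).div_const (√(ν + 1))).mul_const (r k)).const_add
    (columnWithout S j k)
  refine h.congr' ?_
  filter_upwards [eventually_gt_atTop 0] with v hv
  rw [ofResidual_coe]
  field_simp

lemma tendsto_marginIncrements_ofResidual (hν : 0 < ν) (hmono : Monotone T)
    (hlog : Tendsto (fun u => T u - ν * Real.log u) atTop (nhds (-Real.log K)))
    {u : ℝ → ℝ} (hu : Tendsto u atTop atTop)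
    (hut : Tendsto (fun t => t - ν * Real.log (u t)) atTop (nhds (-Real.log K)))
    {s : ℝ} (hs : 0 < s) (r : {k : Fin d // k ≠ j} → ℝ) :
    Tendsto (fun t => marginIncrements T j t (ofResidual ν S j (u t * s, r))) atTop
      (nhds (spectralLimit ν S j r, ν * Real.log s)) := by
  have hv : Tendsto (fun t => u t * s) atTop atTop := hu.atTop_mul_const hs
  refine Tendsto.prodMk_nhds (tendsto_pi_nhds.2 fun k => ?_) ?_
  · by_cases hk : k = j
    · subst hk
      simp
    · lift k to {k : Fin d // k ≠ j} using hk
      simp only [ofResidual_self, spectralLimit_coe]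
      exact tendsto_coe_sub_scaledLog hν hmono hlog hv ((tendsto_ofResidual_div r k).comp hv)
  · simp only [ofResidual_self]
    exact tendsto_sub_of_dilation hlog hu hut hs

variable {Ω : Type*} [MeasurableSpace Ω] {P : Measure Ω} [IsProbabilityMeasure P]
  {Y : Ω → Fin d → ℝ}

lemma measureReal_margin (hν : 0 < ν) (hS : IsCorrelationMatrix S)
    (hY : HasLaw Y (studentT ν 0 S) P) (hT : Measurable T) (j : Fin d) (t : ℝ) :
    P.real {ω | t < T (Y ω j)} = (univStudentT ν).real {y | t < T y} := by
  have hYm := hY.aemeasurable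
  rw [← map_coord hν hS hY j, map_measureReal_apply_of_aemeasurable (by fun_prop)
    (measurableSet_lt measurable_const hT)]
  rfl

/-- The conditioning event involves only Y_j, so it restricts the first factor of the product and
leaves the residual law unchanged. -/
lemma integral_cond_margin (hν : 0 < ν) (hS : IsCorrelationMatrix S)
    (hY : HasLaw Y (studentT ν 0 S) P) (hT : Measurable T) (j : Fin d) (t : ℝ)
    {F : (Fin d → ℝ) → ℝ} (hF : Measurable F) :
    ∫ ω, F (Y ω) ∂(P[|{ω | t < T (Y ω j)}])
      = ((univStudentT ν).real {y | t < T y})⁻¹ * ∫ p, F (ofResidual ν S j p)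
        ∂(((univStudentT ν).restrict {y | t < T y}).prod
          (studentT (ν + 1) 0 (partialMatrix S j))) := by
  have := hY.isProbabilityMeasure_iff.1 inferInstance
  have := isProbabilityMeasure_studentT_partialMatrix hν hS j
  have := isProbabilityMeasure_univStudentT hν
  have hset : MeasurableSet {y : Fin d → ℝ | t < T (y j)} :=
    measurableSet_lt measurable_const (by fun_prop)
  have h1 := setIntegral_map hset hF.aestronglyMeasurable hY.aemeasurable
  rw [hY.map_eq, studentT_eq_map_ofResidual hν hS j,
    setIntegral_map hset hF.aestronglyMeasurable (by fun_prop)] at h1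
  have h2 : ofResidual ν S j ⁻¹' {y : Fin d → ℝ | t < T (y j)} = {y | t < T y} ×ˢ Set.univ := by
    ext p
    simp
  rw [h2, ← Measure.prod_restrict, Measure.restrict_univ] at h1
  rw [h1, ProbabilityTheory.cond, integral_smul_measure, smul_eq_mul,
    ← measureReal_margin hν hS hY hT, ENNReal.toReal_inv]
  rfl

/-- The conditional limit of the margin increments, tested against a bounded continuous function. -/
lemma tendsto_integral_cond_margin (hν : 0 < ν) (hS : IsCorrelationMatrix S)
    (hY : HasLaw Y (studentT ν 0 S) P) (hmono : Monotone T)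
    (hT : Tendsto (fun x => Real.exp x * (univStudentT ν).real {y | x < T y}) atTop (nhds 1))
    (f : BoundedContinuousFunction ((Fin d → EReal) × ℝ) ℝ) :
    Tendsto (fun t => ∫ ω, f (marginIncrements T j t (Y ω)) ∂(P[|{ω | t < T (Y ω j)}])) atTop
      (nhds (∫ p, f (spectralLimit ν S j p.2, ν * Real.log p.1)
        ∂((paretoMeasure 1 ν).prod (studentT (ν + 1) 0 (partialMatrix S j))))) := by
  have := hY.isProbabilityMeasure_iff.1 inferInstance
  have := isProbabilityMeasure_studentT_partialMatrix hν hS j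
  have := isProbabilityMeasure_univStudentT hν
  have hK := studentTTailConst_pos hν
  have hm := tendsto_rpow_mul_univStudentT_Ioi hν
  have hlog := tendsto_quantile_transform hmono hK hm hT
  have : NullSingletonClass (univStudentT ν) := by
    unfold univStudentT
    infer_instance
  obtain ⟨u, hu, hset⟩ := exists_threshold (m := univStudentT ν) hmono
    (tendsto_atTop_of_measureReal_lt hmono hT)
  have hut : Tendsto (fun t => t - ν * Real.log (u t)) atTop
      (nhds (-Real.log (studentTTailConst ν))) := by
    refine tendsto_sub_mul_log hK hu (hT.congr' ?_) (hm.comp hu)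
    filter_upwards [hset] with t ht
    rw [measureReal_congr ht]
  have hF (t : ℝ) : Measurable fun y => f (marginIncrements T j t y) :=
    f.continuous.measurable.comp (measurable_marginIncrements hmono.measurable j t)
  have key := tendsto_rpow_mul_integral_Ioi (μ := studentT (ν + 1) 0 (partialMatrix S j)) hν hu
    (G := fun t p => f (marginIncrements T j t (ofResidual ν S j p)))
    (fun t => (hF t).comp measurable_ofResidual) (C := ‖f‖) (fun t p => f.norm_coe_le_norm _)
    (fun p hp => (f.continuous.tendsto _).comp (tendsto_marginIncrements_ofResidual hν hmono hlog
      hu hut (one_pos.trans_le hp) p.2))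
  -- The conditional expectation is a quotient of two quantities of order u^{-ν} with the same
  -- constant K, which cancels.
  have key2 := ((hm.comp hu).inv₀ hK.ne').mul key
  rw [inv_mul_cancel_left₀ hK.ne'] at key2
  refine key2.congr' ?_
  filter_upwards [hset, hu.eventually_gt_atTop 0] with t ht hut0
  rw [integral_cond_margin hν hS hY hmono.measurable j t (hF t), measureReal_congr ht,
    Measure.restrict_congr_set ht]
  have : 0 < u t ^ ν := by positivity
  simp only [Function.comp_apply, mul_inv]
  field_simp

end Limit

/-! ### Assembly -/

theorem mainTheorem6 {Ω : Type*} [MeasurableSpace Ω] (P : Measure Ω) [IsProbabilityMeasure P]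
    {d : ℕ} (j : Fin d) (ν : ℝ) (hν : 0 < ν)
    (S : Matrix (Fin d) (Fin d) ℝ) (hS : IsCorrelationMatrix S)
    (Y : Ω → Fin d → ℝ) (hY : HasLaw Y (studentT ν 0 S) P) :
    -- the law of the standardized residual, unconditionally and given `Y_j`
    HasLaw (fun ω => standardizedResidual ν S j (Y ω)) (studentT (ν + 1) 0 (partialMatrix S j)) P ∧
    (∀ᵐ y ∂(P.map (fun ω => Y ω j)),
      condDistrib (fun ω => standardizedResidual ν S j (Y ω)) (fun ω => Y ω j) P y
        = studentT (ν + 1) 0 (partialMatrix S j)) ∧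
    -- the conditional limit on exponential-tailed margins `X = T(Y)`
    ∀ T : ℝ → ℝ, Monotone T →
      (fun x : ℝ => P.real {ω | x < T (Y ω j)}) ~[atTop] (fun x : ℝ => Real.exp (-x)) →
      (∀ Tinv : ℝ → ℝ, (∀ᶠ x in atTop, T (Tinv x) = x) →
        Tinv ~[atTop] (fun x : ℝ =>
          (studentTConst ν (1 : Matrix (Fin 1) (Fin 1) ℝ) * ν ^ ((ν - 1) / 2)) ^ (1 / ν)
            * Real.exp (x / ν))) ∧
      ∃ (_ : ∀ t : ℝ, IsProbabilityMeasure (P[|{ω | t < T (Y ω j)}]))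
        (Ω' : Type) (_ : MeasurableSpace Ω') (Q : Measure Ω') (_ : IsProbabilityMeasure Q)
        (Z : Ω' → Fin d → EReal) (E : Ω' → ℝ),
        TendstoInDistribution
          (fun (t : ℝ) (ω : Ω) =>
            ((fun k => ((T (Y ω k) - T (Y ω j) : ℝ) : EReal)), T (Y ω j) - t))
          atTop (fun ω' => (Z ω', E ω')) (fun t : ℝ => P[|{ω | t < T (Y ω j)}]) Q ∧
        HasLaw E (expMeasure 1) Q ∧
        IndepFun Z E Q ∧
        (∀ᵐ ω' ∂Q, Z ω' j = 0) ∧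
        (∀ z : {k : Fin d // k ≠ j} → ℝ,
          Q.real {ω' | ∀ k : {k : Fin d // k ≠ j}, Z ω' k ≤ (z k : EReal)}
            = studentTCDF (ν + 1) (columnWithout S j) ((1 / (ν + 1)) • partialMatrix S j)
                (fun k => Real.exp (z k / ν))) ∧
        (∀ᵐ ω' ∂Q, ∀ k, Z ω' k ≠ ⊤) ∧
        (∀ k, k ≠ j → 0 < Q {ω' | Z ω' k = ⊥} ∧ Q {ω' | Z ω' k = ⊥} < 1) := by
  refine ⟨hasLaw_standardizedResidual hν hS hY j, condDistrib_standardizedResidual hν hS hY j,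
    fun T hmono hTP => ?_⟩
  have := hY.isProbabilityMeasure_iff.1 inferInstance
  have := isProbabilityMeasure_studentT_partialMatrix hν hS j
  have := isProbabilityMeasure_univStudentT hν
  have := isProbabilityMeasure_paretoMeasure one_pos hν
  have hK := studentTTailConst_pos hν
  have hPD := hS.partialMatrix_posDef j
  have hYm := hY.aemeasurable
  simp_rw [measureReal_margin hν hS hY hmono.measurable j] at hTP
  have hT := tendsto_exp_mul_of_isEquivalent hTP
  have hlog := tendsto_quantile_transform hmono hK (tendsto_rpow_mul_univStudentT_Ioi hν) hT
  have hprob (t : ℝ) : IsProbabilityMeasure (P[|{ω | t < T (Y ω j)}]) := by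
    refine cond_isProbabilityMeasure fun h => ?_
    have h1 := measureReal_lt_pos hT t
    rw [← measureReal_margin hν hS hY hmono.measurable j, measureReal_def, h] at h1
    simp at h1
  set μR := studentT (ν + 1) 0 (partialMatrix S j) with hμR
  have hmeasX (t : ℝ) : AEMeasurable (fun ω => marginIncrements T j t (Y ω))
      (P[|{ω | t < T (Y ω j)}]) :=
    (measurable_marginIncrements hmono.measurable j t).comp_aemeasurable
      (hYm.mono_ac cond_absolutelyContinuous)
  have hmeasZ : Measurable fun p : ℝ × ({k : Fin d // k ≠ j} → ℝ) =>
      (spectralLimit ν S j p.2, ν * Real.log p.1) := by fun_prop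
  -- The limit lives on the product of the Pareto law and the residual law. E depends only on the
  -- first coordinate and Z only on the second, whence independence.
  refine ⟨fun Tinv hinv => isEquivalent_rightInverse hν hmono hK hlog hinv, hprob,
    ℝ × ({k : Fin d // k ≠ j} → ℝ), inferInstance, (paretoMeasure 1 ν).prod μR, inferInstance,
    fun p => spectralLimit ν S j p.2, fun p => ν * Real.log p.1,
    ⟨hmeasX, hmeasZ.aemeasurable, ?_⟩, ⟨by fun_prop, ?_⟩, ?_, ?_, fun z => ?_, ?_, fun k hk => ?_⟩
  · refine ProbabilityMeasure.tendsto_iff_forall_integral_tendsto.2 fun f => ?_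
    have h := tendsto_integral_cond_margin (j := j) hν hS hY hmono hT f
    simp only [ProbabilityMeasure.coe_mk]
    rw [integral_map hmeasZ.aemeasurable f.continuous.measurable.aestronglyMeasurable]
    refine h.congr fun t => ?_
    exact (integral_map (hmeasX t) f.continuous.measurable.aestronglyMeasurable).symm
  · have h : (fun p : ℝ × ({k : Fin d // k ≠ j} → ℝ) => ν * Real.log p.1)
        = (fun s => ν * Real.log s) ∘ Prod.fst := rfl
    rw [h, ← Measure.map_map (by fun_prop) measurable_fst, Measure.map_fst_prod, measure_univ,
      one_smul, map_log_paretoMeasure hν]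
  · exact (indepFun_prod (X := fun s => ν * Real.log s) (Y := spectralLimit ν S j)
      (by fun_prop) (by fun_prop)).symm
  · exact ae_of_all _ fun p => spectralLimit_self _
  · have ha : (0 : ℝ) < 1 / √(ν + 1) := by positivity
    have ha2 : (1 / √(ν + 1)) ^ 2 = 1 / (ν + 1) := by
      rw [div_pow, Real.sq_sqrt (by positivity), one_pow]
    have hset : {p : ℝ × ({k : Fin d // k ≠ j} → ℝ) | ∀ k : {k : Fin d // k ≠ j},
        spectralLimit ν S j p.2 k ≤ (z k : EReal)} = Set.univ ×ˢ
        ((fun r => columnWithout S j + (1 / √(ν + 1)) • r) ⁻¹'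
          Set.Iic (fun k => Real.exp (z k / ν))) := by
      ext p
      simp [scaledLog_le_coe_iff hν, Pi.le_def]
    rw [hset, studentTCDF, ← ha2, ← map_studentT_add_smul ha hPD, measureReal_prod_prod,
      probReal_univ, one_mul, map_measureReal_apply (by fun_prop) measurableSet_Iic]
  · exact ae_of_all _ fun p k => spectralLimit_ne_top _ k
  · lift k to {k : Fin d // k ≠ j} using hk
    have ha : (0 : ℝ) < 1 / √(ν + 1) := by positivity
    have hopen := isOpenPosMeasure_studentT (by positivity : 0 < ν + 1) hPD 0
    have hcont : Continuous fun r : {k : Fin d // k ≠ j} → ℝ =>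
        columnWithout S j k + 1 / √(ν + 1) * r k := by fun_prop
    -- The values c = -1 and c = 1 show that the open sets where the limiting ratio is negative or
    -- positive are nonempty, hence of positive mass.
    have hattain (c : ℝ) : ∃ r : {k : Fin d // k ≠ j} → ℝ,
        columnWithout S j k + 1 / √(ν + 1) * r k = c :=
      ⟨fun _ => (c - columnWithout S j k) / (1 / √(ν + 1)), by field_simp; ring⟩
    have hset : {p : ℝ × ({k : Fin d // k ≠ j} → ℝ) | spectralLimit ν S j p.2 k = ⊥}
        = Set.univ ×ˢ {r | columnWithout S j k + 1 / √(ν + 1) * r k ≤ 0} := by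
      ext p
      simp [scaledLog_eq_bot_iff]
    rw [hset, Measure.prod_prod, measure_univ, one_mul]
    constructor
    · obtain ⟨r, hr⟩ := hattain (-1)
      refine ((isOpen_lt hcont continuous_const).measure_pos μR
        ⟨r, hr.trans_lt neg_one_lt_zero⟩).trans_le (measure_mono ?_)
      exact Set.ofPred_subset_ofPred.2 fun r hr => le_of_lt hr
    · obtain ⟨r, hr⟩ := hattain 1
      have hO := isOpen_lt (continuous_const (y := (0 : ℝ))) hcont
      have hpos := hO.measure_pos μR ⟨r, one_pos.trans_eq hr.symm⟩
      have hlt := ENNReal.sub_lt_self ENNReal.one_ne_top one_ne_zero hpos.ne'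
      rw [← prob_compl_eq_one_sub hO.measurableSet] at hlt
      simpa only [Set.compl_ofPred, not_lt] using hlt
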